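/- Let $(\mathcal R,\mu)$ be a $\sigma$-finite measure space. For a measurable extended complex-valued function $f$ on $\mathcal R$ let $f_*(s)=\mu(\{|f|>s\})$, $s\in[0,\infty)$, and let $f^*(t)=\inf\{s\ge 0 : f_*(s)\le t\}$, $t\in[0,\infty)$, be its non-increasing rearrangement. Assume that $(\mathcal R,\mu)$ is resonant, i.e. $\sup_{\tilde g^*=g^*}\int_{\mathcal R}|f\tilde g|\,d\mu=\int_0^\infty f^*(t)g^*(t)\,dt$ for all measurable $f,g$. A rearrangement-invariant (r.i.) quasi-Banach function norm is a functional $\|\cdot\|_X$ with values in $[0,\infty]$ on the measurable functions, such that $\|f\|_X=\|\,|f|\,\|_X$, such that $\|f\|_X=\|g\|_X$ whenever $f^*=g^*$, and such that on the non-negative functions: $\|af\|_X=|a|\,\|f\|_X$ for scalars $a$; $\|f\|_X=0$ iff $f=0$ a.e.; $\|f+g\|_X\le K(\|f\|_X+\|g\|_X)$ for some constant $K\ge 1$; $f\le g$ a.e. implies $\|f\|_X\le\|g\|_X$; $f_n\uparrow f$ a.e. implies $\|f_n\|_X\uparrow\|f\|_X$; and $\|\chi_E\|_X<\infty$ if $\mu(E)<\infty$.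 The corresponding r.i. quasi-Banach function space is $X=\{f:\|f\|_X<\infty\}$ (functions being identified if they agree a.e.), with the topology induced by its quasinorm. Let $\phi\colon\mathcal R\to\mathcal R$ be measurable and measure-bounded, i.e. there is $A\in(0,\infty)$ with $\mu(\phi^{-1}(E))\le A\mu(E)$ for every measurable $E$, and let $T_\phi f=f\circ\phi$. Then the following three statements are equivalent: 1. $\phi$ is measure-bounded from below, i.e. there is $C\in(0,\infty)$ with $\mu(E)\le C\mu(\phi^{-1}(E))$ for every measurable $E$ with $\mu(E)<\infty$. 2. $T_\phi\colon L^1\to L^1$ is injective and has closed range. 3. For every r.i. quasi-Banach function space $X$ over $(\mathcal R,\mu)$ there is a constant $c>0$ such that $\|f\|_X\le c\|T_\phi f\|_X$ for every $f\in X$. Moreover, for each r.i. quasi-Banach function space $X$ for which the estimate in 3 holds with some constant $c>0$, $T_\phi$ maps $X$ into $X$, and $T_\phi\colon X\to X$ is injective and has closed range. -/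

import Mathlib

open MeasureTheory Filter Topology Set
open scoped NNReal ENNReal

noncomputable section

namespace RISpace

variable {R : Type*} [MeasurableSpace R]

/-- The distribution function `s ↦ μ {x | f x > s}` of a nonnegative function with values
in `[0, ∞]`. -/
def distribution (μ : Measure R) (f : R → ℝ≥0∞) (s : ℝ≥0) : ℝ≥0∞ :=
  μ {x | (s : ℝ≥0∞) < f x}

/-- The non-increasing rearrangement `f^*(t) = inf {s ∈ [0, ∞) | f_*(s) ≤ t}`, `t ∈ [0, ∞)`
(the infimum of the empty set is `∞`). -/
def rearrangement (μ : Measure R) (f : R → ℝ≥0∞) (t : ℝ≥0) : ℝ≥0∞ :=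
  ⨅ (s : ℝ≥0) (_ : distribution μ f s ≤ t), (s : ℝ≥0∞)

/-- Resonance of a measure space: the supremum of `∫ f h dμ` over all `h` equimeasurable with `g`
is `∫₀^∞ f^* g^* dλ`. Only the moduli of the functions enter, so it is enough to speak about
`[0, ∞]`-valued measurable functions. -/
def Resonant (μ : Measure R) : Prop :=
  ∀ f g : R → ℝ≥0∞, Measurable f → Measurable g →
    (⨆ (h : R → ℝ≥0∞) (_ : Measurable h) (_ : rearrangement μ h = rearrangement μ g),
      ∫⁻ x, f x * h x ∂μ) =
      ∫⁻ t in Ioi (0 : ℝ), rearrangement μ f t.toNNReal * rearrangement μ g t.toNNReal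

/-- `φ` is measure-bounded: `μ (φ⁻¹ E) ≤ A μ E` for all measurable `E`, for some `A ∈ (0, ∞)`. -/
def MeasureBounded (μ : Measure R) (φ : R → R) : Prop :=
  ∃ A : ℝ≥0, 0 < A ∧ ∀ E : Set R, MeasurableSet E → μ (φ ⁻¹' E) ≤ A * μ E

/-- `φ` is measure-bounded from below: `μ E ≤ C μ (φ⁻¹ E)` for all measurable `E` of finite
measure, for some `C ∈ (0, ∞)`. -/
def MeasureBoundedBelow (μ : Measure R) (φ : R → R) : Prop :=
  ∃ C : ℝ≥0, 0 < C ∧ ∀ E : Set R, MeasurableSet E → μ E < ∞ → μ E ≤ C * μ (φ ⁻¹' E)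

/-- A rearrangement-invariant quasi-Banach function norm over `μ`. Such a norm satisfies
`‖f‖ = ‖|f|‖`, so it is given by its values on the nonnegative measurable functions (with values in
`[0, ∞]`); by `mono'` it depends on the almost-everywhere class of the function only. The values of
`toFun` at non-measurable functions are never used. -/
structure RIQuasiNorm (μ : Measure R) where
  toFun : (R → ℝ≥0∞) → ℝ≥0∞
  smul' : ∀ (a : ℝ≥0) (f : R → ℝ≥0∞), Measurable f →
    toFun (fun x => (a : ℝ≥0∞) * f x) = a * toFun f
  eq_zero_iff' : ∀ f : R → ℝ≥0∞, Measurable f → (toFun f = 0 ↔ f =ᵐ[μ] 0)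
  add_le' : ∃ C : ℝ≥0, 1 ≤ C ∧ ∀ f g : R → ℝ≥0∞, Measurable f → Measurable g →
    toFun (fun x => f x + g x) ≤ C * (toFun f + toFun g)
  mono' : ∀ f g : R → ℝ≥0∞, Measurable f → Measurable g → f ≤ᵐ[μ] g → toFun f ≤ toFun g
  /-- the Fatou property -/
  fatou' : ∀ (f : ℕ → R → ℝ≥0∞) (g : R → ℝ≥0∞), (∀ n, Measurable (f n)) → Measurable g →
    (∀ᵐ x ∂μ, Monotone (fun n => f n x) ∧ Tendsto (fun n => f n x) atTop (𝓝 (g x))) →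
    Monotone (fun n => toFun (f n)) ∧ Tendsto (fun n => toFun (f n)) atTop (𝓝 (toFun g))
  indicator_lt_top' : ∀ E : Set R, MeasurableSet E → μ E < ∞ →
    toFun (E.indicator fun _ => 1) < ∞
  /-- rearrangement invariance -/
  rearrangement_eq' : ∀ f g : R → ℝ≥0∞, Measurable f → Measurable g →
    rearrangement μ f = rearrangement μ g → toFun f = toFun g

namespace RIQuasiNorm

variable {μ : Measure R} (X : RIQuasiNorm μ)

/-- A function of finite quasinorm is finite almost everywhere. Hence the space `X` consists of
(classes of) complex-valued functions. -/
theorem ae_lt_top (f : R → ℝ≥0∞) (hf : Measurable f) (h : X.toFun f < ∞) :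
    ∀ᵐ x ∂μ, f x < ∞ := by
  set E : Set R := {x | f x = ∞} with hE
  have hEm : MeasurableSet E := hf (measurableSet_singleton _)
  have hi : Measurable (E.indicator fun _ => (1 : ℝ≥0∞)) := measurable_const.indicator hEm
  have key : ∀ n : ℕ, (n : ℝ≥0∞) * X.toFun (E.indicator fun _ => 1) ≤ X.toFun f := by
    intro n
    have := X.smul' n _ hi
    rw [ENNReal.coe_natCast] at this
    rw [← this]
    refine X.mono' _ _ (hi.const_mul _) hf (ae_of_all _ fun x => ?_)
    by_cases hx : x ∈ E
    · have : f x = ∞ := hx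
      simp [this]
    · simp [hx]
  have h0 : X.toFun (E.indicator fun _ => 1) = 0 := by
    by_contra hne
    obtain ⟨n, hn⟩ := ENNReal.exists_nat_mul_gt hne h.ne
    exact absurd (key n) (not_le.2 hn)
  filter_upwards [(X.eq_zero_iff' _ hi).1 h0] with x hx
  by_contra hx'
  have : x ∈ E := by simpa [hE] using hx'
  simp [this] at hx

/-- The quasinorm `‖f‖_X` of (the class of) a complex-valued measurable function. -/
def qnorm (f : R →ₘ[μ] ℂ) : ℝ≥0∞ := X.toFun (fun x => ‖f x‖ₑ)

theorem measurable_enorm (f : R →ₘ[μ] ℂ) : Measurable (fun x => ‖f x‖ₑ) :=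
  f.measurable.enorm

/-- The r.i. quasi-Banach function space `X = {f | ‖f‖_X < ∞}`. -/
def space : Submodule ℂ (R →ₘ[μ] ℂ) where
  carrier := {f | X.qnorm f < ∞}
  zero_mem' := by
    have : X.qnorm 0 = 0 := by
      refine (X.eq_zero_iff' _ (measurable_enorm _)).2 ?_
      filter_upwards [AEEqFun.coeFn_zero (μ := μ) (α := R) (β := ℂ)] with x hx
      simp [hx]
    simp [this]
  add_mem' := by
    intro f g hf hg
    obtain ⟨C, -, hC⟩ := X.add_le'
    have h1 : X.qnorm (f + g) ≤ C * (X.qnorm f + X.qnorm g) := by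
      refine le_trans (X.mono' _ _ (measurable_enorm _)
        ((measurable_enorm f).add (measurable_enorm g)) ?_)
        (hC _ _ (measurable_enorm f) (measurable_enorm g))
      filter_upwards [AEEqFun.coeFn_add f g] with x hx
      simpa [hx] using enorm_add_le (f x) (g x)
    exact h1.trans_lt (ENNReal.mul_lt_top ENNReal.coe_lt_top (ENNReal.add_lt_top.2 ⟨hf, hg⟩))
  smul_mem' := by
    intro a f hf
    have h1 : X.qnorm (a • f) ≤ ‖a‖₊ * X.qnorm f := by
      unfold qnorm
      rw [← X.smul' ‖a‖₊ _ (measurable_enorm f)]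
      refine X.mono' _ _ (measurable_enorm _) ((measurable_enorm f).const_mul _) ?_
      filter_upwards [AEEqFun.coeFn_smul a f] with x hx
      simp [hx, enorm_eq_nnnorm]
    exact h1.trans_lt (ENNReal.mul_lt_top ENNReal.coe_lt_top hf)

/-- The topology of `X` induced by its quasinorm: `U` is open iff around each of its points it
contains a quasinorm ball. -/
@[reducible]
def topology : TopologicalSpace X.space where
  IsOpen U := ∀ f ∈ U, ∃ ε : ℝ≥0∞, 0 < ε ∧
    ∀ g : X.space, X.qnorm ((g : R →ₘ[μ] ℂ) - (f : R →ₘ[μ] ℂ)) < ε → g ∈ U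
  isOpen_univ := fun _ _ => ⟨1, one_pos, fun _ _ => mem_univ _⟩
  isOpen_inter := by
    rintro U V hU hV f ⟨hfU, hfV⟩
    obtain ⟨ε, hε, h1⟩ := hU f hfU
    obtain ⟨δ, hδ, h2⟩ := hV f hfV
    exact ⟨min ε δ, lt_min hε hδ, fun g hg =>
      ⟨h1 g (hg.trans_le (min_le_left _ _)), h2 g (hg.trans_le (min_le_right _ _))⟩⟩
  isOpen_sUnion := by
    rintro S hS f ⟨U, hUS, hfU⟩
    obtain ⟨ε, hε, h⟩ := hS U hUS f hfU
    exact ⟨ε, hε, fun g hg => ⟨U, hUS, h g hg⟩⟩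

end RIQuasiNorm

variable {μ : Measure R} {φ : R → R}

/-- A measure-bounded map is non-singular. -/
theorem MeasureBounded.quasiMeasurePreserving (hb : MeasureBounded μ φ) (hφ : Measurable φ) :
    Measure.QuasiMeasurePreserving φ μ μ := by
  obtain ⟨A, -, hA⟩ := hb
  refine ⟨hφ, Measure.AbsolutelyContinuous.mk fun E hE h0 => ?_⟩
  rw [Measure.map_apply hφ hE]
  simpa [h0] using hA E hE

/-- The composition operator `T_φ f = f ∘ φ` on classes of measurable functions, for a
non-singular `φ`. -/
def compOp (h : Measure.QuasiMeasurePreserving φ μ μ) : (R →ₘ[μ] ℂ) →ₗ[ℂ] (R →ₘ[μ] ℂ) where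
  toFun f := f.compQuasiMeasurePreserving φ h
  map_add' f g := by
    induction f using AEEqFun.induction_on
    induction g using AEEqFun.induction_on
    rfl
  map_smul' a f := by
    induction f using AEEqFun.induction_on
    rfl

theorem MeasureBounded.compOp_mem_Lp (hb : MeasureBounded μ φ) (hφ : Measurable φ)
    (f : Lp ℂ 1 μ) :
    compOp (hb.quasiMeasurePreserving hφ) (f : R →ₘ[μ] ℂ) ∈ Lp ℂ 1 μ := by
  have hq := hb.quasiMeasurePreserving hφ
  obtain ⟨A, -, hA⟩ := hb
  have hle : Measure.map φ μ ≤ A • μ := by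
    refine Measure.le_iff.2 fun E hE => ?_
    rw [Measure.map_apply hφ hE]
    exact hA E hE
  have hf : MemLp (f : R → ℂ) 1 (Measure.map φ μ) :=
    ((Lp.memLp f).smul_measure (c := (A : ℝ≥0∞)) ENNReal.coe_ne_top).mono_measure hle
  have hcomp : MemLp ((f : R → ℂ) ∘ φ) 1 μ := hf.comp_of_map hφ.aemeasurable
  exact Lp.mem_Lp_iff_memLp.2
    (hcomp.ae_eq (AEEqFun.coeFn_compQuasiMeasurePreserving (f : R →ₘ[μ] ℂ) hq).symm)

/-- `T_φ` as a linear operator on `L^1`, for a measure-bounded `φ`. -/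
def compL1 (hb : MeasureBounded μ φ) (hφ : Measurable φ) : Lp ℂ 1 μ →ₗ[ℂ] Lp ℂ 1 μ where
  toFun f := ⟨compOp (hb.quasiMeasurePreserving hφ) (f : R →ₘ[μ] ℂ), hb.compOp_mem_Lp hφ f⟩
  map_add' f g := Subtype.ext
    ((compOp (hb.quasiMeasurePreserving hφ)).map_add (f : R →ₘ[μ] ℂ) (g : R →ₘ[μ] ℂ))
  map_smul' a f := Subtype.ext
    ((compOp (hb.quasiMeasurePreserving hφ)).map_smul a (f : R →ₘ[μ] ℂ))

/-- The estimate `‖f‖_X ≤ c ‖T f‖_X` for all `f ∈ X`, with some constant `c ∈ (0, ∞)`. -/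
def BoundedFromBelowOn (X : RIQuasiNorm μ) (T : (R →ₘ[μ] ℂ) →ₗ[ℂ] (R →ₘ[μ] ℂ)) : Prop :=
  ∃ c : ℝ≥0, 0 < c ∧ ∀ f ∈ X.space, X.qnorm f ≤ c * X.qnorm (T f)

/-- `T` maps `X` into `X`, and `T : X → X` is injective and has closed range. -/
def InjectiveClosedRangeOn (X : RIQuasiNorm μ) (T : (R →ₘ[μ] ℂ) →ₗ[ℂ] (R →ₘ[μ] ℂ)) : Prop :=
  ∃ hT : ∀ f ∈ X.space, T f ∈ X.space,
    Function.Injective (T.restrict hT) ∧ IsClosed[X.topology] (Set.range (T.restrict hT))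

end RISpace

end

/-! Everything rests on a dilation estimate, `exists_toFun_le_of_distribution_le`: if the
distribution function of `f` is at most `N` times that of `g`, then `‖f‖_X ≤ K ‖g‖_X` with `K`
depending only on `X` and `N`. Composition with `φ` replaces the level sets of `|f|` by their
preimages. Measure-boundedness thus makes `T_φ` bounded on every `X`, and measure-boundedness from
below makes it bounded from below on every `X`. Taking `X = L^1` gives injectivity and closed range
there. Conversely, by the open mapping theorem, these two properties make `T_φ` bounded from below
on `L^1`, and indicator functions turn that bound into the measure inequality.

The dilation estimate is proved directly on the measure space. Resonance tested on indicators shows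
that a set of finite measure has a copy of equal measure inside any set at least as large
(`exists_subset_measure_eq`). Chains of level sets can therefore be moved into larger chains
(`exists_chain_subset_measure_eq`) and cut into pieces of controlled size (`exists_chain_split`).
Rearrangement invariance and the quasi-triangle inequality settle step functions; dyadic
approximation and the Fatou property settle the rest.

The final claim is the usual Cauchy sequence argument, with completeness of `X` obtained from the
Fatou property. -/

namespace RISpace

/-! ### Distribution functions and rearrangements. -/

section Distribution

variable {R : Type*} [MeasurableSpace R] {μ : Measure R}

theorem distribution_antitone (f : R → ℝ≥0∞) : Antitone (distribution μ f) := fun s t hst =>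
  measure_mono fun x (hx : (t : ℝ≥0∞) < f x) =>
    show (s : ℝ≥0∞) < f x from (ENNReal.coe_le_coe.2 hst).trans_lt hx

/-- The distribution function is right-continuous. -/
theorem distribution_le_of_forall_lt {f : R → ℝ≥0∞} {s : ℝ≥0} {a : ℝ≥0∞}
    (h : ∀ r, s < r → distribution μ f r ≤ a) : distribution μ f s ≤ a := by
  obtain ⟨u, hu, hsu, hlim⟩ := exists_seq_strictAnti_tendsto s
  have hset : {x | (s : ℝ≥0∞) < f x} = ⋃ n, {x | (u n : ℝ≥0∞) < f x} := by
    ext x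
    simp only [mem_ofPred_eq, mem_iUnion]
    refine ⟨fun hx => ?_, fun ⟨n, hn⟩ => (ENNReal.coe_lt_coe.2 (hsu n)).trans hn⟩
    exact ((ENNReal.tendsto_coe.2 hlim).eventually_lt_const hx).exists
  have hmono : Monotone fun n => {x | (u n : ℝ≥0∞) < f x} := fun m n hmn x hx =>
    (ENNReal.coe_le_coe.2 (hu.antitone hmn)).trans_lt hx
  rw [distribution, hset, hmono.measure_iUnion]
  exact iSup_le fun n => h _ (hsu n)

/-- Right-continuity of the distribution function means that a finite infimum defining the
rearrangement is attained. -/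
theorem rearrangement_le_iff {f : R → ℝ≥0∞} {s t : ℝ≥0} :
    rearrangement μ f t ≤ s ↔ distribution μ f s ≤ t := by
  refine ⟨fun h => distribution_le_of_forall_lt fun r hr => ?_, fun h => iInf₂_le s h⟩
  have : rearrangement μ f t < r := h.trans_lt (ENNReal.coe_lt_coe.2 hr)
  simp only [rearrangement, iInf_lt_iff] at this
  obtain ⟨q, hq, hqr⟩ := this
  exact (distribution_antitone f (ENNReal.coe_le_coe.1 hqr.le)).trans hq

/-- A finite value of the distribution function can be used as an argument `t` of the rearrangement
in `rearrangement_le_iff`; an infinite value makes the upper bound trivial. -/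
theorem distribution_eq_of_rearrangement_eq {f g : R → ℝ≥0∞}
    (h : rearrangement μ f = rearrangement μ g) : distribution μ f = distribution μ g := by
  have key : ∀ f g : R → ℝ≥0∞, rearrangement μ f = rearrangement μ g →
      ∀ s, distribution μ f s ≤ distribution μ g s := by
    intro f g h s
    by_cases hg : distribution μ g s = ∞
    · simp [hg]
    · lift distribution μ g s to ℝ≥0 using hg with a ha
      rw [← rearrangement_le_iff, h, rearrangement_le_iff, ha]
  exact funext fun s => le_antisymm (key f g h s) (key g f h.symm s)

theorem rearrangement_eq_of_distribution_eq {f g : R → ℝ≥0∞}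
    (h : distribution μ f = distribution μ g) : rearrangement μ f = rearrangement μ g := by
  funext t
  simp only [rearrangement, h]

theorem distribution_indicator_one (E : Set R) (s : ℝ≥0) :
    distribution μ (E.indicator fun _ => 1) s = if s < 1 then μ E else 0 := by
  unfold distribution
  split_ifs with hs
  · congr 1
    ext x
    by_cases hx : x ∈ E <;> simp [hx, hs]
  · convert measure_empty (μ := μ)
    ext x
    by_cases hx : x ∈ E <;> simp [hx]
    exact not_lt.1 hs

theorem rearrangement_indicator_one {E : Set R} {t : ℝ≥0} (ht : (t : ℝ≥0∞) < μ E) :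
    1 ≤ rearrangement μ (E.indicator fun _ => 1) t := by
  refine le_iInf₂ fun s hs => ?_
  by_contra hlt
  rw [distribution_indicator_one, if_pos (by exact_mod_cast not_le.1 hlt)] at hs
  exact absurd ht (not_lt.2 hs)

end Distribution

/-! ### Moving sets and chains of sets in a resonant space. -/

namespace Resonant

variable {R : Type*} [MeasurableSpace R] {μ : Measure R}

/-- For the indicators of `F` and `E` the right side of resonance is at least `μ E`, so some `h`
equimeasurable with `χ_E` has integral over `F` above `a`. Such an `h` is at most `1` a.e., and `E'
= {h > 0}` works. -/
theorem exists_measure_eq_lt_measure_inter (hμ : Resonant μ) {E F : Set R}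
    (hE : MeasurableSet E) (hF : MeasurableSet F) (hEF : μ E ≤ μ F) (hfin : μ E < ∞)
    {a : ℝ≥0∞} (ha : a < μ E) :
    ∃ E' : Set R, MeasurableSet E' ∧ μ E' = μ E ∧ a < μ (E' ∩ F) := by
  have h1 := hμ (F.indicator fun _ => 1) (E.indicator fun _ => 1)
    (measurable_const.indicator hF) (measurable_const.indicator hE)
  have h2 : μ E ≤ ∫⁻ t in Ioi (0 : ℝ), rearrangement μ (F.indicator fun _ => 1) t.toNNReal *
      rearrangement μ (E.indicator fun _ => 1) t.toNNReal := by
    calc μ E = ∫⁻ _ in Ioo (0 : ℝ) (μ E).toReal, 1 := by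
          simp [ENNReal.ofReal_toReal hfin.ne]
      _ ≤ ∫⁻ t in Ioo (0 : ℝ) (μ E).toReal,
          rearrangement μ (F.indicator fun _ => 1) t.toNNReal *
            rearrangement μ (E.indicator fun _ => 1) t.toNNReal := by
          refine setLIntegral_mono' measurableSet_Ioo fun t ht => ?_
          have htE : ((t.toNNReal : ℝ≥0) : ℝ≥0∞) < μ E := by
            exact (ENNReal.ofReal_lt_iff_lt_toReal ht.1.le hfin.ne).2 ht.2
          exact one_le_mul (rearrangement_indicator_one (htE.trans_le hEF))
            (rearrangement_indicator_one htE)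
      _ ≤ _ := lintegral_mono_set Ioo_subset_Ioi_self
  have h3 := ha.trans_le (h2.trans_eq h1.symm)
  simp only [lt_iSup_iff] at h3
  obtain ⟨h, hm, hr, hlt⟩ := h3
  have hd := distribution_eq_of_rearrangement_eq hr
  have h0 := congrFun hd 0
  have h1' := congrFun hd 1
  simp only [distribution_indicator_one, zero_lt_one, lt_irrefl, if_true, if_false] at h0 h1'
  have hm0 : MeasurableSet {x | ((0 : ℝ≥0) : ℝ≥0∞) < h x} := measurableSet_lt measurable_const hm
  refine ⟨{x | ((0 : ℝ≥0) : ℝ≥0∞) < h x}, hm0, h0, hlt.trans_le ?_⟩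
  rw [← lintegral_indicator_one (hm0.inter hF)]
  refine lintegral_mono_ae ?_
  have hae : ∀ᵐ x ∂μ, h x ≤ 1 := by
    rw [ae_iff]
    simpa [distribution] using h1'
  filter_upwards [hae] with x hx
  by_cases hxF : x ∈ F
  · by_cases hx0 : h x = 0
    · simp [hx0]
    · have : x ∈ {x | ((0 : ℝ≥0) : ℝ≥0∞) < h x} ∩ F := ⟨by simpa [pos_iff_ne_zero] using hx0, hxF⟩
      rw [indicator_of_mem hxF, indicator_of_mem this, one_mul]
      exact hx
  · simp [hxF]

/-- In a resonant space, a set of finite measure has an equimeasurable copy inside every set of at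
least the same measure. -/
theorem exists_subset_measure_eq (hμ : Resonant μ) {E F : Set R}
    (hE : MeasurableSet E) (hF : MeasurableSet F) (hEF : μ E ≤ μ F) (hfin : μ E < ∞) :
    ∃ F' ⊆ F, MeasurableSet F' ∧ μ F' = μ E := by
  let S := {p : Set R × Set R // MeasurableSet p.1 ∧ MeasurableSet p.2 ∧ μ p.1 ≤ μ p.2 ∧ μ p.1 < ∞}
  -- A pair in `S` records a set whose measure is still to be matched and the part of `F` still
  -- free. Each step uses up more than half of the missing measure (if any is missing), so the used
  -- parts of `F` exhaust `μ E` in the limit.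
  have step : ∀ p : S, ∃ q : S, q.1.2 ⊆ p.1.2 ∧ μ q.1.1 ≤ μ p.1.1 / 2 ∧
      μ (p.1.2 \ q.1.2) + μ q.1.1 = μ p.1.1 := by
    rintro ⟨⟨E, F⟩, hE, hF, hEF, hfin⟩
    by_cases h0 : μ E = 0
    · exact ⟨⟨⟨E, F⟩, hE, hF, hEF, hfin⟩, subset_rfl, by simp [h0], by simp⟩
    obtain ⟨E', hE', hE'E, hlt⟩ := hμ.exists_measure_eq_lt_measure_inter hE hF hEF hfin
      (ENNReal.half_lt_self h0 hfin.ne)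
    have hadd : μ (E' ∩ F) + μ (E' \ F) = μ E := by
      rw [measure_inter_add_sdiff E' hF, hE'E]
    have hadd' : μ (E' ∩ F) + μ (F \ E') = μ F := by
      rw [inter_comm, measure_inter_add_sdiff F hE']
    have hinter : μ (E' ∩ F) ≠ ∞ := ((le_self_add.trans_eq hadd).trans_lt hfin).ne
    refine ⟨⟨⟨E' \ F, F \ E'⟩, hE'.diff hF, hF.diff hE', ?_, ?_⟩, sdiff_subset, ?_, ?_⟩
    · rw [← hadd, ← hadd'] at hEF
      exact (ENNReal.add_le_add_iff_left hinter).1 hEF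
    · exact (le_add_self.trans_eq hadd).trans_lt hfin
    · have h2 : μ E / 2 + μ (E' \ F) ≤ μ E / 2 + μ E / 2 := by
        rw [ENNReal.add_halves]
        exact (add_le_add_left hlt.le _).trans_eq hadd
      exact (ENNReal.add_le_add_iff_left (ENNReal.div_lt_top hfin.ne two_ne_zero).ne).1 h2
    · change μ (F \ (F \ E')) + _ = _
      rw [Set.sdiff_sdiff_right_self, inter_comm, hadd]
  choose next hsub hhalf hadd using step
  let u : ℕ → S := fun n => next^[n] ⟨⟨E, F⟩, hE, hF, hEF, hfin⟩
  have hu : ∀ n, u (n + 1) = next (u n) := fun n => Function.iterate_succ_apply' next n _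
  have hanti : Antitone fun n => (u n).1.2 := antitone_nat_of_succ_le fun n => by
    rw [hu]; exact hsub _
  have hF0 : ∀ n, (u n).1.2 ⊆ F := fun n => hanti (Nat.zero_le n)
  have hsum : ∀ n, μ (F \ (u n).1.2) + μ (u n).1.1 = μ E := by
    intro n
    induction n with
    | zero => simp [u]
    | succ n ih =>
      rw [← ih, ← hadd (u n), ← add_assoc, ← hu]
      congr 1
      have hs : (u (n + 1)).1.2 ⊆ (u n).1.2 := hanti n.le_succ
      rw [← measure_union (disjoint_sdiff_left.mono_right sdiff_subset)
        ((u n).2.2.1.diff (u (n + 1)).2.2.1)]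
      rw [sdiff_union_sdiff_cancel (hF0 n) hs]
  have hpow : ∀ n, μ (u n).1.1 ≤ μ E * 2⁻¹ ^ n := by
    intro n
    induction n with
    | zero => simp [u]
    | succ n ih =>
      rw [hu, pow_succ, ← mul_assoc]
      exact (hhalf _).trans (by rw [div_eq_mul_inv]; gcongr)
  have hlim0 : Tendsto (fun n => μ (u n).1.1) atTop (𝓝 0) := by
    refine tendsto_of_tendsto_of_tendsto_of_le_of_le tendsto_const_nhds ?_
      (fun _ => zero_le) hpow
    have := ENNReal.Tendsto.const_mul (a := μ E)
      (ENNReal.tendsto_pow_atTop_nhds_zero_of_lt_one (r := 2⁻¹) (by simp)) (Or.inr hfin.ne)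
    simpa using this
  have hmono : Monotone fun n => F \ (u n).1.2 := fun m n hmn => sdiff_subset_sdiff_right (hanti hmn)
  refine ⟨⋃ n, F \ (u n).1.2, iUnion_subset fun n => sdiff_subset,
    MeasurableSet.iUnion fun n => hF.diff (u n).2.2.1, ?_⟩
  have hl1 := (tendsto_measure_iUnion_atTop (μ := μ) hmono).add hlim0
  simp only [Function.comp_apply, hsum, add_zero] at hl1
  exact tendsto_nhds_unique hl1 tendsto_const_nhds |>.symm ▸ rfl

/-- In a resonant space, every set has a subset of measure `min (μ F) (μ G - μ A)`. -/
theorem exists_subset_measure_eq_min (hμ : Resonant μ) {A F G : Set R}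
    (hA : MeasurableSet A) (hF : MeasurableSet F) (hG : MeasurableSet G) (hAG : μ A ≤ μ G)
    (hAfin : μ A < ∞) (hFfin : μ F < ∞) :
    ∃ D ⊆ F, MeasurableSet D ∧ μ D = min (μ F) (μ G - μ A) := by
  rcases le_total (μ F) (μ G - μ A) with h | h
  · exact ⟨F, subset_rfl, hF, (min_eq_left h).symm⟩
  -- Removing a copy of `A` from `G` produces a set of measure exactly `μ G - μ A`, which can then
  -- be copied into `F`.
  · obtain ⟨G', hG'G, hG', hG'A⟩ := hμ.exists_subset_measure_eq hA hG hAG hAfin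
    have hd : μ (G \ G') = μ G - μ A := by
      rw [measure_sdiff hG'G hG'.nullMeasurableSet (hG'A ▸ hAfin.ne), hG'A]
    obtain ⟨D, hDF, hD, hDm⟩ := hμ.exists_subset_measure_eq (hG.diff hG') hF (hd ▸ h)
      (hd ▸ h.trans_lt hFfin)
    exact ⟨D, hDF, hD, by rw [hDm, hd, min_eq_right h]⟩

/-- Equimeasurable transport of an increasing sequence of sets. -/
theorem exists_chain_subset_measure_eq (hμ : Resonant μ) {A G : ℕ → Set R}
    (hA : Monotone A) (hAm : ∀ n, MeasurableSet (A n)) (hAfin : ∀ n, μ (A n) < ∞)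
    (hG : Monotone G) (hGm : ∀ n, MeasurableSet (G n)) (hAG : ∀ n, μ (A n) ≤ μ (G n)) :
    ∃ B : ℕ → Set R, Monotone B ∧ (∀ n, MeasurableSet (B n)) ∧ (∀ n, B n ⊆ G n) ∧
      ∀ n, μ (B n) = μ (A n) := by
  have hex : ∀ E F : Set R, ∃ F' : Set R, MeasurableSet E → MeasurableSet F → μ E ≤ μ F →
      μ E < ∞ → F' ⊆ F ∧ MeasurableSet F' ∧ μ F' = μ E := by
    intro E F
    by_cases h : MeasurableSet E ∧ MeasurableSet F ∧ μ E ≤ μ F ∧ μ E < ∞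
    · obtain ⟨F', h1, h2⟩ := hμ.exists_subset_measure_eq h.1 h.2.1 h.2.2.1 h.2.2.2
      exact ⟨F', fun _ _ _ _ => ⟨h1, h2⟩⟩
    · exact ⟨∅, fun h1 h2 h3 h4 => absurd ⟨h1, h2, h3, h4⟩ h⟩
  choose sub hsub using hex
  -- Each increment of the chain `A` is copied into the part of `G (n + 1)` not yet occupied.
  let B : ℕ → Set R := fun n => Nat.rec (sub (A 0) (G 0))
    (fun n B => B ∪ sub (A (n + 1) \ A n) (G (n + 1) \ B)) n
  have key : ∀ n, MeasurableSet (B n) ∧ B n ⊆ G n ∧ μ (B n) = μ (A n) := by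
    intro n
    induction n with
    | zero =>
      obtain ⟨h1, h2, h3⟩ := hsub (A 0) (G 0) (hAm 0) (hGm 0) (hAG 0) (hAfin 0)
      exact ⟨h2, h1, h3⟩
    | succ n ih =>
      obtain ⟨i1, i2, i3⟩ := ih
      have hBG : B n ⊆ G (n + 1) := i2.trans (hG n.le_succ)
      have hBfin : μ (B n) ≠ ∞ := i3 ▸ (hAfin n).ne
      have hle : μ (A (n + 1) \ A n) ≤ μ (G (n + 1) \ B n) := by
        rw [measure_sdiff (hA n.le_succ) (hAm n).nullMeasurableSet (hAfin n).ne,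
          measure_sdiff hBG i1.nullMeasurableSet hBfin, i3]
        exact tsub_le_tsub_right (hAG _) _
      obtain ⟨h1, h2, h3⟩ := hsub (A (n + 1) \ A n) (G (n + 1) \ B n)
        ((hAm _).diff (hAm _)) ((hGm _).diff i1) hle
        ((measure_mono sdiff_subset).trans_lt (hAfin _))
      refine ⟨i1.union h2, union_subset hBG (h1.trans sdiff_subset), ?_⟩
      change μ (B n ∪ sub (A (n + 1) \ A n) (G (n + 1) \ B n)) = _
      rw [measure_union (disjoint_sdiff_right.mono_right h1) h2, h3, i3,
        measure_add_sdiff (hAm n).nullMeasurableSet, union_eq_self_of_subset_left (hA n.le_succ)]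
  exact ⟨B, monotone_nat_of_le_succ fun n => subset_union_left, fun n => (key n).1,
    fun n => (key n).2.1, fun n => (key n).2.2⟩

/-- Splitting of an increasing sequence `E` with `μ (E n) ≤ (N + 1) μ (G n)` into two increasing
sequences, dominated by `μ (G n)` and `N μ (G n)`. -/
theorem exists_chain_split (hμ : Resonant μ) {E G : ℕ → Set R} {N : ℕ}
    (hE : Monotone E) (hEm : ∀ n, MeasurableSet (E n)) (hEfin : ∀ n, μ (E n) < ∞)
    (hG : Monotone G) (hGm : ∀ n, MeasurableSet (G n))
    (hEG : ∀ n, μ (E n) ≤ (N + 1 : ℕ) * μ (G n)) :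
    ∃ A : ℕ → Set R, Monotone A ∧ Monotone (fun n => E n \ A n) ∧ (∀ n, MeasurableSet (A n)) ∧
      (∀ n, A n ⊆ E n) ∧ (∀ n, μ (A n) ≤ μ (G n)) ∧ ∀ n, μ (E n \ A n) ≤ N * μ (G n) := by
  have hex : ∀ A F G : Set R, ∃ D : Set R, MeasurableSet A → MeasurableSet F → MeasurableSet G →
      μ A ≤ μ G → μ A < ∞ → μ F < ∞ → D ⊆ F ∧ MeasurableSet D ∧ μ D = min (μ F) (μ G - μ A) := by
    intro A F G
    by_cases h : MeasurableSet A ∧ MeasurableSet F ∧ MeasurableSet G ∧ μ A ≤ μ G ∧ μ A < ∞ ∧ μ F < ∞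
    · obtain ⟨h1, h2, h3, h4, h5, h6⟩ := h
      obtain ⟨D, hD⟩ := hμ.exists_subset_measure_eq_min h1 h2 h3 h4 h5 h6
      exact ⟨D, fun _ _ _ _ _ _ => hD⟩
    · exact ⟨∅, fun h1 h2 h3 h4 h5 h6 => absurd ⟨h1, h2, h3, h4, h5, h6⟩ h⟩
  choose sub hsub using hex
  have top_up : ∀ {E A G : Set R}, MeasurableSet A → A ⊆ E → μ E < ∞ → μ A = μ G →
      μ E ≤ (N + 1 : ℕ) * μ G → μ (E \ A) ≤ N * μ G := by
    intro E A G hA hAE hEfin hAG hEG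
    rw [measure_sdiff hAE hA.nullMeasurableSet ((measure_mono hAE).trans_lt hEfin).ne, hAG]
    refine tsub_le_iff_right.2 (hEG.trans_eq ?_)
    push_cast
    ring
  -- Greedy choice: `A` takes as much of each new increment of `E` as the budget `μ (G n)` allows.
  -- Either the budget is exhausted and `top_up` applies, or the whole increment is taken up to a
  -- null set and the remainder does not grow in measure.
  let A : ℕ → Set R := fun n => Nat.rec (sub ∅ (E 0) (G 0))
    (fun n A => A ∪ sub A (E (n + 1) \ E n) (G (n + 1))) n
  have key : ∀ n, MeasurableSet (A n) ∧ A n ⊆ E n ∧ μ (A n) ≤ μ (G n) ∧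
      μ (E n \ A n) ≤ N * μ (G n) := by
    intro n
    induction n with
    | zero =>
      obtain ⟨h1, h2, h3⟩ := hsub ∅ (E 0) (G 0) .empty (hEm 0) (hGm 0) (by simp) (by simp) (hEfin 0)
      rw [measure_empty, tsub_zero] at h3
      refine ⟨h2, h1, h3.trans_le (min_le_right _ _), ?_⟩
      rcases le_total (μ (E 0)) (μ (G 0)) with h | h
      · rw [min_eq_left h] at h3
        change μ (E 0 \ sub ∅ (E 0) (G 0)) ≤ _
        rw [measure_sdiff h1 h2.nullMeasurableSet (h3 ▸ (hEfin 0).ne), h3]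
        simp
      · exact top_up h2 h1 (hEfin 0) (h3.trans (min_eq_right h)) (hEG 0)
    | succ n ih =>
      obtain ⟨i1, i2, i3, i4⟩ := ih
      have hAfin : μ (A n) < ∞ := (measure_mono i2).trans_lt (hEfin n)
      have hAG : μ (A n) ≤ μ (G (n + 1)) := i3.trans (measure_mono (hG n.le_succ))
      obtain ⟨h1, h2, h3⟩ := hsub (A n) (E (n + 1) \ E n) (G (n + 1)) i1 ((hEm _).diff (hEm _))
        (hGm _) hAG hAfin ((measure_mono sdiff_subset).trans_lt (hEfin _))
      set D := sub (A n) (E (n + 1) \ E n) (G (n + 1)) with hD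
      have hDA : Disjoint (A n) D := disjoint_sdiff_right.mono i2 h1
      have hAD : A (n + 1) = A n ∪ D := rfl
      have hsubset : A n ∪ D ⊆ E (n + 1) :=
        union_subset (i2.trans (hE n.le_succ)) (h1.trans sdiff_subset)
      rw [hAD]
      refine ⟨i1.union h2, hsubset, ?_, ?_⟩
      · rw [measure_union hDA h2, h3, ← add_tsub_cancel_of_le hAG]
        gcongr
        rw [add_tsub_cancel_of_le hAG]
        exact min_le_right _ _
      · rcases le_total (μ (E (n + 1) \ E n)) (μ (G (n + 1)) - μ (A n)) with h | h
        · rw [min_eq_left h] at h3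
          have h0 : μ ((E (n + 1) \ E n) \ D) = 0 := by
            rw [measure_sdiff h1 h2.nullMeasurableSet
              ((measure_mono (h1.trans sdiff_subset)).trans_lt (hEfin _)).ne, h3, tsub_self]
          calc μ (E (n + 1) \ (A n ∪ D)) ≤ μ ((E n \ A n) ∪ ((E (n + 1) \ E n) \ D)) := by
                refine measure_mono fun x hx => ?_
                simp only [Set.mem_sdiff, mem_union, not_or] at hx ⊢
                tauto
            _ ≤ μ (E n \ A n) + μ ((E (n + 1) \ E n) \ D) := measure_union_le _ _
            _ ≤ N * μ (G (n + 1)) := by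
                rw [h0, add_zero]
                exact i4.trans (by gcongr; exact hG n.le_succ)
        · rw [min_eq_right h] at h3
          refine top_up (i1.union h2) hsubset (hEfin _) ?_ (hEG _)
          rw [measure_union hDA h2, h3, add_tsub_cancel_of_le hAG]
  refine ⟨A, monotone_nat_of_le_succ fun n => subset_union_left,
    monotone_nat_of_le_succ fun n => ?_, fun n => (key n).1, fun n => (key n).2.1,
    fun n => (key n).2.2.1, fun n => (key n).2.2.2⟩
  have hEn : MeasurableSet (A n) ∧ A n ⊆ E n ∧ μ (A n) ≤ μ (G n) ∧ _ := key n
  obtain ⟨i1, i2, i3, -⟩ := hEn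
  obtain ⟨h1, -, -⟩ := hsub (A n) (E (n + 1) \ E n) (G (n + 1)) i1 ((hEm _).diff (hEm _))
    (hGm _) (i3.trans (measure_mono (hG n.le_succ))) ((measure_mono i2).trans_lt (hEfin n))
    ((measure_mono sdiff_subset).trans_lt (hEfin _))
  -- Later additions to `A` come from outside `E n`, so a point of `E n` once left out stays out.
  rintro x ⟨hxE, hxA⟩
  refine ⟨hE n.le_succ hxE, ?_⟩
  rintro (hx | hx)
  · exact hxA hx
  · exact (h1 hx).2 hxE

end Resonant

end RISpace

namespace RISpace

/-! ### Step functions over increasing chains of sets. -/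

section ChainSup

variable {R : Type*}

/-- The step function `max_{i < m} c i · χ_{E i}`. -/
noncomputable def chainSup (E : ℕ → Set R) (c : ℕ → ℝ≥0) (m : ℕ) (x : R) : ℝ≥0∞ :=
  ⨆ (i : ℕ) (_ : i < m), (E i).indicator (fun _ => (c i : ℝ≥0∞)) x

theorem lt_chainSup_iff {E : ℕ → Set R} {c : ℕ → ℝ≥0} {m : ℕ} {s : ℝ≥0} {x : R} :
    (s : ℝ≥0∞) < chainSup E c m x ↔ ∃ i < m, s < c i ∧ x ∈ E i := by
  simp only [chainSup, lt_iSup_iff, exists_prop]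
  refine exists_congr fun i => and_congr_right fun _ => ?_
  by_cases hx : x ∈ E i <;> simp [hx]

theorem chainSup_mono {A B : ℕ → Set R} (h : ∀ n, A n ⊆ B n) (c : ℕ → ℝ≥0) (m : ℕ) :
    chainSup A c m ≤ chainSup B c m := fun x =>
  iSup₂_mono fun i _ => indicator_le_indicator_of_subset (h i) (fun _ => zero_le) x

theorem chainSup_le_add_sdiff (E A : ℕ → Set R) (c : ℕ → ℝ≥0) (m : ℕ) (x : R) :
    chainSup E c m x ≤ chainSup A c m x + chainSup (fun n => E n \ A n) c m x := by
  refine iSup₂_le fun i hi => ?_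
  refine le_trans ?_ (add_le_add
    (le_iSup₂ (f := fun i (_ : i < m) => (A i).indicator (fun _ => (c i : ℝ≥0∞)) x) i hi)
    (le_iSup₂ (f := fun i (_ : i < m) => (E i \ A i).indicator (fun _ => (c i : ℝ≥0∞)) x) i hi))
  by_cases hx : x ∈ E i <;> by_cases hx' : x ∈ A i <;> simp [hx, hx']

variable [MeasurableSpace R] {μ : Measure R}

theorem measurable_chainSup {E : ℕ → Set R} (hE : ∀ n, MeasurableSet (E n)) (c : ℕ → ℝ≥0) (m : ℕ) :
    Measurable (chainSup E c m) :=
  Measurable.iSup fun i => Measurable.iSup fun _ => measurable_const.indicator (hE i)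

/-- The distribution function of a step function over an increasing sequence depends on the
measures of the sets only. -/
theorem distribution_chainSup_congr {A B : ℕ → Set R} (hA : Monotone A) (hB : Monotone B)
    (hAB : ∀ n, μ (A n) = μ (B n)) (c : ℕ → ℝ≥0) (m : ℕ) :
    distribution μ (chainSup A c m) = distribution μ (chainSup B c m) := by
  funext s
  unfold distribution
  simp only [lt_chainSup_iff]
  -- The superlevel set at `s` is the union of the sets with index in `T`; for a monotone chain this
  -- is the set with the largest such index.
  let T := (Finset.range m).filter fun i => s < c i
  have hT : ∀ i, i ∈ T ↔ i < m ∧ s < c i := by simp [T]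
  rcases T.eq_empty_or_nonempty with h | h
  · have : ∀ E : ℕ → Set R, {x | ∃ i < m, s < c i ∧ x ∈ E i} = ∅ := fun E => by
      refine eq_empty_of_forall_notMem fun x ⟨i, him, hi, _⟩ => ?_
      have := (hT i).2 ⟨him, hi⟩
      simp [h] at this
    rw [this, this]
  · have : ∀ E : ℕ → Set R, Monotone E → {x | ∃ i < m, s < c i ∧ x ∈ E i} = E (T.max' h) := by
      intro E hE
      ext x
      refine ⟨fun ⟨i, him, hi, hx⟩ => hE (T.le_max' i ((hT i).2 ⟨him, hi⟩)) hx, fun hx => ?_⟩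
      obtain ⟨h1, h2⟩ := (hT _).1 (T.max'_mem h)
      exact ⟨_, h1, h2, hx⟩
    rw [this A hA, this B hB, hAB]

end ChainSup

/-! ### The dilation estimate. -/

namespace RIQuasiNorm

variable {R : Type*} [MeasurableSpace R] {μ : Measure R} (X : RIQuasiNorm μ)

theorem toFun_congr_ae {f g : R → ℝ≥0∞} (hf : Measurable f) (hg : Measurable g) (h : f =ᵐ[μ] g) :
    X.toFun f = X.toFun g :=
  le_antisymm (X.mono' _ _ hf hg h.le) (X.mono' _ _ hg hf h.symm.le)

/-- Moving the chain `A` inside `G` preserves the distribution function of the step function, after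
which pointwise monotonicity applies. -/
theorem toFun_chainSup_le (hμ : Resonant μ) {A G : ℕ → Set R}
    (hA : Monotone A) (hAm : ∀ n, MeasurableSet (A n)) (hAfin : ∀ n, μ (A n) < ∞)
    (hG : Monotone G) (hGm : ∀ n, MeasurableSet (G n)) (hAG : ∀ n, μ (A n) ≤ μ (G n))
    (c : ℕ → ℝ≥0) (m : ℕ) : X.toFun (chainSup A c m) ≤ X.toFun (chainSup G c m) := by
  obtain ⟨B, hB, hBm, hBG, hBA⟩ := hμ.exists_chain_subset_measure_eq hA hAm hAfin hG hGm hAG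
  rw [X.rearrangement_eq' _ _ (measurable_chainSup hAm c m) (measurable_chainSup hBm c m)
    (rearrangement_eq_of_distribution_eq
      (distribution_chainSup_congr hA hB (fun n => (hBA n).symm) c m))]
  exact X.mono' _ _ (measurable_chainSup hBm c m) (measurable_chainSup hGm c m)
    (ae_of_all _ (chainSup_mono hBG c m))

/-- The dilation estimate for step functions. -/
theorem exists_toFun_chainSup_le (hμ : Resonant μ) (N : ℕ) :
    ∃ K : ℝ≥0, ∀ E G : ℕ → Set R, Monotone E → (∀ n, MeasurableSet (E n)) →
      (∀ n, μ (E n) < ∞) → Monotone G → (∀ n, MeasurableSet (G n)) →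
      (∀ n, μ (E n) ≤ N * μ (G n)) → ∀ (c : ℕ → ℝ≥0) (m : ℕ),
      X.toFun (chainSup E c m) ≤ K * X.toFun (chainSup G c m) := by
  induction N with
  | zero =>
    refine ⟨0, fun E G hE hEm _ _ _ hEG c m => ?_⟩
    rw [ENNReal.coe_zero, zero_mul, nonpos_iff_eq_zero,
      X.eq_zero_iff' _ (measurable_chainSup hEm c m)]
    have h0 : ∀ᵐ x ∂μ, ∀ n, x ∉ E n := ae_all_iff.2 fun n => by
      refine measure_eq_zero_iff_ae_notMem.1 ?_
      simpa using hEG n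
    filter_upwards [h0] with x hx
    simp [chainSup, hx]
  | succ N ih =>
    obtain ⟨K, hK⟩ := ih
    obtain ⟨C, -, hC⟩ := X.add_le'
    -- The chain splits into one piece dominated by `G`, contributing `1`, and one dominated
    -- `N`-fold, contributing the inductive constant `K`.
    refine ⟨C * (1 + K), fun E G hE hEm hEfin hG hGm hEG c m => ?_⟩
    obtain ⟨A, hA, hEA, hAm, hAE, hAG, hEAG⟩ := hμ.exists_chain_split hE hEm hEfin hG hGm hEG
    have hdm : ∀ n, MeasurableSet (E n \ A n) := fun n => (hEm n).diff (hAm n)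
    calc X.toFun (chainSup E c m)
        ≤ X.toFun (fun x => chainSup A c m x + chainSup (fun n => E n \ A n) c m x) :=
          X.mono' _ _ (measurable_chainSup hEm c m)
            ((measurable_chainSup hAm c m).add (measurable_chainSup hdm c m))
            (ae_of_all _ (chainSup_le_add_sdiff E A c m))
      _ ≤ C * (X.toFun (chainSup A c m) + X.toFun (chainSup (fun n => E n \ A n) c m)) :=
          hC _ _ (measurable_chainSup hAm c m) (measurable_chainSup hdm c m)
      _ ≤ C * (X.toFun (chainSup G c m) + K * X.toFun (chainSup G c m)) := by
          gcongr
          · exact X.toFun_chainSup_le hμ hA hAm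
              (fun n => (measure_mono (hAE n)).trans_lt (hEfin n)) hG hGm hAG c m
          · exact hK _ G hEA hdm (fun n => (measure_mono sdiff_subset).trans_lt (hEfin n)) hG hGm
              hEAG c m
      _ = (C * (1 + K) : ℝ≥0) * X.toFun (chainSup G c m) := by
          push_cast
          ring

/-- The dilation estimate: if the distribution function of `f` is dominated by a multiple of that
of `g`, then the quasinorm of `f` is dominated by a multiple of that of `g`. -/
theorem exists_toFun_le_of_distribution_le [SigmaFinite μ] (hμ : Resonant μ) (N : ℕ) :
    ∃ K : ℝ≥0, ∀ f g : R → ℝ≥0∞, Measurable f → Measurable g →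
      (∀ (s : ℝ≥0) (S : Set R), MeasurableSet S → μ S < ∞ →
        μ ({x | (s : ℝ≥0∞) < f x} ∩ S) ≤ N * distribution μ g s) →
      X.toFun f ≤ K * X.toFun g := by
  obtain ⟨K, hK⟩ := X.exists_toFun_chainSup_le hμ N
  refine ⟨2 * K, fun f g hf hg hfg => ?_⟩
  -- For `i ≤ 2 n` the levels run from `2 ^ n` down to `2 ^ (-n)`. They decrease in `i`, so the
  -- superlevel sets increase; cutting with `spanningSets` keeps those of `f` of finite measure.
  let c : ℕ → ℕ → ℝ≥0 := fun n i => (2 : ℝ≥0) ^ ((n : ℤ) - i)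
  have hc : ∀ n, Antitone (c n) := fun n i j hij =>
    zpow_le_zpow_right₀ one_le_two (by omega)
  let E : ℕ → ℕ → Set R := fun n i => {x | (c n i : ℝ≥0∞) < f x} ∩ spanningSets μ n
  let G : ℕ → ℕ → Set R := fun n i => {x | (c n i : ℝ≥0∞) < g x}
  have hEm : ∀ n i, MeasurableSet (E n i) := fun n i =>
    (measurableSet_lt measurable_const hf).inter (measurableSet_spanningSets μ n)
  have hGm : ∀ n i, MeasurableSet (G n i) := fun n i => measurableSet_lt measurable_const hg
  have hlev : ∀ n (h : R → ℝ≥0∞), Monotone fun i => {x | (c n i : ℝ≥0∞) < h x} :=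
    fun n h i j hij x hx => (ENNReal.coe_le_coe.2 (hc n hij)).trans_lt hx
  let u : ℕ → R → ℝ≥0∞ := fun n => chainSup (E n) (c n) (2 * n + 1)
  have hum : ∀ n, Measurable (u n) := fun n => measurable_chainSup (hEm n) _ _
  have hu : ∀ n, X.toFun (u n) ≤ K * X.toFun g := fun n => by
    refine (hK (E n) (G n) (fun i j hij => inter_subset_inter_left _ (hlev n f hij)) (hEm n)
      (fun i => (measure_mono inter_subset_right).trans_lt (measure_spanningSets_lt_top μ n))
      (hlev n g) (hGm n) (fun i => hfg _ _ (measurableSet_spanningSets μ n)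
        (measure_spanningSets_lt_top μ n)) (c n) (2 * n + 1)).trans ?_
    gcongr
    refine X.mono' _ _ (measurable_chainSup (hGm n) _ _) hg (ae_of_all _ fun x => ?_)
    refine iSup₂_le fun i _ => ?_
    by_cases hx : x ∈ G n i
    · simpa [hx] using le_of_lt hx
    · simp [hx]
  have hmono : ∀ x, Monotone fun n => u n x := fun x => monotone_nat_of_le_succ fun n => by
    refine iSup₂_le fun i hi => ?_
    -- The new top level `2 ^ (n + 1)` shifts all old levels by one index.
    have hci : c (n + 1) (i + 1) = c n i := by simp [c]
    have hEi : E n i ⊆ E (n + 1) (i + 1) := by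
      simp only [E, hci]
      exact inter_subset_inter_right _ (monotone_spanningSets μ n.le_succ)
    refine le_trans ?_ (le_iSup₂ (f := fun j (_ : j < 2 * (n + 1) + 1) =>
      (E (n + 1) j).indicator (fun _ => (c (n + 1) j : ℝ≥0∞)) x) (i + 1) (by omega))
    simp only [hci]
    exact indicator_le_indicator_of_subset hEi (fun _ => zero_le) x
  let F : R → ℝ≥0∞ := fun x => ⨆ n, u n x
  have hFm : Measurable F := Measurable.iSup hum
  have hF : X.toFun F ≤ K * X.toFun g := le_of_tendsto'
    (X.fatou' u F hum hFm (ae_of_all _ fun x => ⟨hmono x, tendsto_atTop_iSup (hmono x)⟩)).2 hu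
  have hfF : ∀ x, f x ≤ ((2 : ℝ≥0) : ℝ≥0∞) * F x := fun x => by
    refine ENNReal.le_of_forall_nnreal_lt fun r hr => ?_
    rcases eq_or_ne r 0 with rfl | h0
    · simp
    -- With `2 ^ k ≤ r < 2 ^ (k + 1)`, the level `2 ^ k` occurs in `u n` as soon as `n ≥ |k|`;
    -- rounding down to it costs the factor `2`.
    obtain ⟨k, hk1, hk2⟩ := exists_mem_Ico_zpow (y := (2 : ℝ≥0)) (pos_iff_ne_zero.2 h0) one_lt_two
    obtain ⟨n₀, hn₀⟩ := mem_iUnion.1 ((iUnion_spanningSets μ).symm ▸ mem_univ x :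
      x ∈ ⋃ n, spanningSets μ n)
    obtain ⟨n, hn1, hn2⟩ : ∃ n : ℕ, n₀ ≤ n ∧ k.natAbs ≤ n :=
      ⟨max n₀ k.natAbs, le_max_left _ _, le_max_right _ _⟩
    obtain ⟨i, hi⟩ : ∃ i : ℕ, (i : ℤ) = n - k := ⟨((n : ℤ) - k).toNat, by omega⟩
    have hci : c n i = 2 ^ k := by simp only [c]; congr 1; omega
    have hx : x ∈ E n i := ⟨by
      change (c n i : ℝ≥0∞) < f x
      rw [hci]
      exact (ENNReal.coe_le_coe.2 hk1).trans_lt hr, monotone_spanningSets μ hn1 hn₀⟩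
    have h1 : (c n i : ℝ≥0∞) ≤ F x := by
      refine le_trans ?_ (le_iSup (fun n => u n x) n)
      refine le_trans ?_ (le_iSup₂ (f := fun j (_ : j < 2 * n + 1) =>
        (E n j).indicator (fun _ => (c n j : ℝ≥0∞)) x) i (by omega))
      simp [hx]
    calc (r : ℝ≥0∞) ≤ ((2 * c n i : ℝ≥0) : ℝ≥0∞) := by
          rw [hci, mul_comm, ← zpow_add_one₀ two_ne_zero]
          exact ENNReal.coe_le_coe.2 hk2.le
      _ ≤ _ := by
          rw [ENNReal.coe_mul]
          gcongr
  calc X.toFun f ≤ X.toFun (fun x => ((2 : ℝ≥0) : ℝ≥0∞) * F x) :=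
        X.mono' _ _ hf (hFm.const_mul _) (ae_of_all _ hfF)
    _ = ((2 : ℝ≥0) : ℝ≥0∞) * X.toFun F := X.smul' 2 F hFm
    _ ≤ (2 * K : ℝ≥0) * X.toFun g := by
        rw [ENNReal.coe_mul, mul_assoc]
        gcongr

end RIQuasiNorm

end RISpace

namespace RISpace

/-! ### `L^1` as a rearrangement-invariant space. -/

section L1

variable {R : Type*} [MeasurableSpace R] {μ : Measure R}

/-- The layer cake formula. -/
theorem lintegral_eq_lintegral_distribution [SigmaFinite μ] {f : R → ℝ≥0∞} (hf : Measurable f) :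
    ∫⁻ x, f x ∂μ = ∫⁻ s in Ioi (0 : ℝ), distribution μ f s.toNNReal := by
  have hvol : ∀ a : ℝ≥0∞, ∫⁻ s in Ioi (0 : ℝ),
      {s : ℝ | ENNReal.ofReal s < a}.indicator (fun _ => (1 : ℝ≥0∞)) s = a := by
    intro a
    have hm : MeasurableSet {s : ℝ | ENNReal.ofReal s < a} :=
      measurableSet_lt ENNReal.measurable_ofReal measurable_const
    rw [lintegral_indicator_const hm, one_mul, Measure.restrict_apply hm]
    by_cases ha : a = ∞
    · subst ha
      have : {s : ℝ | ENNReal.ofReal s < ∞} ∩ Ioi 0 = Ioi 0 := by ext; simp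
      rw [this, Real.volume_Ioi]
    · have : {s : ℝ | ENNReal.ofReal s < a} ∩ Ioi 0 = Ioo 0 a.toReal := by
        ext s
        simp only [mem_inter_iff, mem_ofPred_eq, mem_Ioi, mem_Ioo]
        rw [and_comm]
        exact and_congr_right fun hs => ENNReal.ofReal_lt_iff_lt_toReal hs.le ha
      rw [this, Real.volume_Ioo, sub_zero, ENNReal.ofReal_toReal ha]
  have hmeas : MeasurableSet {p : R × ℝ | ENNReal.ofReal p.2 < f p.1} :=
    measurableSet_lt (ENNReal.measurable_ofReal.comp measurable_snd) (hf.comp measurable_fst)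
  calc ∫⁻ x, f x ∂μ
      = ∫⁻ x, (∫⁻ s in Ioi (0 : ℝ),
          {s : ℝ | ENNReal.ofReal s < f x}.indicator (fun _ => (1 : ℝ≥0∞)) s) ∂μ :=
        lintegral_congr fun x => (hvol (f x)).symm
    _ = ∫⁻ s in Ioi (0 : ℝ), ∫⁻ x,
          {s : ℝ | ENNReal.ofReal s < f x}.indicator (fun _ => (1 : ℝ≥0∞)) s ∂μ :=
        lintegral_lintegral_swap (f := fun x s =>
          {s : ℝ | ENNReal.ofReal s < f x}.indicator (fun _ => (1 : ℝ≥0∞)) s)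
          (measurable_const.indicator hmeas).aemeasurable
    _ = _ := by
        refine lintegral_congr fun s => ?_
        have hm : MeasurableSet {x | ENNReal.ofReal s < f x} := measurableSet_lt measurable_const hf
        exact lintegral_indicator_one hm

/-- The norm of `L^1` as a rearrangement-invariant function norm. -/
noncomputable def l1Norm (μ : Measure R) [SigmaFinite μ] : RIQuasiNorm μ where
  toFun f := ∫⁻ x, f x ∂μ
  smul' a f hf := lintegral_const_mul _ hf
  eq_zero_iff' f hf := lintegral_eq_zero_iff hf
  add_le' := ⟨1, le_rfl, fun f g hf _ => by simp [lintegral_add_left hf]⟩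
  mono' f g _ _ h := lintegral_mono_ae h
  fatou' f g hf _ h := ⟨fun m n hmn => lintegral_mono_ae (h.mono fun x hx => hx.1 hmn),
    lintegral_tendsto_of_tendsto_of_monotone (fun n => (hf n).aemeasurable)
      (h.mono fun x hx => hx.1) (h.mono fun x hx => hx.2)⟩
  indicator_lt_top' E hE h := by simpa [lintegral_indicator_const hE] using h
  rearrangement_eq' f g hf hg h := by
    rw [lintegral_eq_lintegral_distribution hf, lintegral_eq_lintegral_distribution hg,
      distribution_eq_of_rearrangement_eq h]

theorem qnorm_l1Norm_coe [SigmaFinite μ] (f : Lp ℂ 1 μ) :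
    (l1Norm μ).qnorm (f : R →ₘ[μ] ℂ) = ‖f‖ₑ := by
  rw [Lp.enorm_def, eLpNorm_one_eq_lintegral_enorm]
  rfl

end L1

/-! ### Completeness and closed range. -/

namespace RIQuasiNorm

variable {R : Type*} [MeasurableSpace R] {μ : Measure R} (X : RIQuasiNorm μ)

theorem qnorm_eq_zero_iff {f : R →ₘ[μ] ℂ} : X.qnorm f = 0 ↔ f = 0 := by
  rw [qnorm, X.eq_zero_iff' _ (measurable_enorm f)]
  refine ⟨fun h => AEEqFun.ext ?_, fun h => ?_⟩
  · filter_upwards [h, AEEqFun.coeFn_zero (μ := μ) (α := R) (β := ℂ)] with x hx h0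
    rw [h0]
    simpa using hx
  · subst h
    filter_upwards [AEEqFun.coeFn_zero (μ := μ) (α := R) (β := ℂ)] with x h0
    simp [h0]

theorem qnorm_sub_comm (f g : R →ₘ[μ] ℂ) : X.qnorm (f - g) = X.qnorm (g - f) := by
  refine X.toFun_congr_ae (measurable_enorm _) (measurable_enorm _) ?_
  filter_upwards [AEEqFun.coeFn_sub f g, AEEqFun.coeFn_sub g f] with x h1 h2
  rw [h1, h2, Pi.sub_apply, Pi.sub_apply, enorm_sub_rev]

theorem qnorm_add_le {C : ℝ≥0} (hC : ∀ f g : R → ℝ≥0∞, Measurable f → Measurable g →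
    X.toFun (fun x => f x + g x) ≤ C * (X.toFun f + X.toFun g)) (f g : R →ₘ[μ] ℂ) :
    X.qnorm (f + g) ≤ C * (X.qnorm f + X.qnorm g) := by
  refine le_trans (X.mono' _ _ (measurable_enorm _)
    ((measurable_enorm f).add (measurable_enorm g)) ?_)
    (hC _ _ (measurable_enorm f) (measurable_enorm g))
  filter_upwards [AEEqFun.coeFn_add f g] with x hx
  simpa [hx] using enorm_add_le (f x) (g x)

theorem qnorm_sub_le {C : ℝ≥0} (hC : ∀ f g : R → ℝ≥0∞, Measurable f → Measurable g →
    X.toFun (fun x => f x + g x) ≤ C * (X.toFun f + X.toFun g)) (f g h : R →ₘ[μ] ℂ) :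
    X.qnorm (f - h) ≤ C * (X.qnorm (f - g) + X.qnorm (g - h)) := by
  rw [← sub_add_sub_cancel f g h]
  exact X.qnorm_add_le hC _ _

/-- Countable subadditivity for geometrically decaying sequences. -/
theorem toFun_tsum_le {C : ℝ≥0} (hC1 : 1 ≤ C) (hC : ∀ f g : R → ℝ≥0∞, Measurable f →
    Measurable g → X.toFun (fun x => f x + g x) ≤ C * (X.toFun f + X.toFun g))
    {h : ℕ → R → ℝ≥0∞} (hm : ∀ n, Measurable (h n))
    (hh : ∀ n, X.toFun (h n) ≤ (((2 * C)⁻¹ ^ n : ℝ≥0) : ℝ≥0∞)) (n : ℕ) :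
    X.toFun (fun x => ∑' k, h (n + k) x) ≤ ((2 * C * (2 * C)⁻¹ ^ n : ℝ≥0) : ℝ≥0∞) := by
  have hsm : ∀ m n, Measurable fun x => ∑ k ∈ Finset.range m, h (n + k) x := fun m n =>
    Finset.measurable_fun_sum _ fun k _ => hm _
  -- With `r = (2 C)⁻¹`, splitting off the first term gives `C (r ^ n + 2 C r ^ (n + 1)) = 2 C r ^
  -- n`, so the bound reproduces itself and is uniform in `m`.
  have hfin : ∀ m n, X.toFun (fun x => ∑ k ∈ Finset.range m, h (n + k) x) ≤
      ((2 * C * (2 * C)⁻¹ ^ n : ℝ≥0) : ℝ≥0∞) := by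
    intro m
    induction m with
    | zero =>
      intro n
      have : X.toFun (fun _ => 0) = 0 := (X.eq_zero_iff' _ measurable_const).2 EventuallyEq.rfl
      simp [this]
    | succ m ih =>
      intro n
      have hsplit : (fun x => ∑ k ∈ Finset.range (m + 1), h (n + k) x) =
          fun x => h n x + ∑ k ∈ Finset.range m, h (n + 1 + k) x := by
        funext x
        rw [Finset.sum_range_succ', add_comm]
        simp only [add_zero, add_assoc, add_comm 1]
      rw [hsplit]
      refine (hC _ _ (hm n) (hsm m (n + 1))).trans ?_
      refine (mul_le_mul_right (add_le_add (hh n) (ih (n + 1))) _).trans_eq ?_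
      rw [← ENNReal.coe_add, ← ENNReal.coe_mul, ENNReal.coe_inj]
      have : C ≠ 0 := (zero_lt_one.trans_le hC1).ne'
      rw [pow_succ]
      field_simp
      ring
  refine le_of_tendsto' (X.fatou' (fun m x => ∑ k ∈ Finset.range m, h (n + k) x) _
    (fun m => hsm m n) (Measurable.tsum fun k => hm _) (ae_of_all _ fun x => ⟨?_, ?_⟩)).2
    fun m => hfin m n
  · exact fun a b hab => Finset.sum_le_sum_of_subset (Finset.range_mono hab)
  · exact ENNReal.tendsto_nat_tsum _

/-- Completeness of `X`: a sequence with sufficiently small increments converges. -/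
theorem exists_tendsto_qnorm_sub {C : ℝ≥0} (hC1 : 1 ≤ C) (hC : ∀ f g : R → ℝ≥0∞, Measurable f →
    Measurable g → X.toFun (fun x => f x + g x) ≤ C * (X.toFun f + X.toFun g))
    {f : ℕ → R →ₘ[μ] ℂ}
    (hf : ∀ n, X.qnorm (f (n + 1) - f n) ≤ (((2 * C)⁻¹ ^ n : ℝ≥0) : ℝ≥0∞)) :
    ∃ g : R →ₘ[μ] ℂ, Tendsto (fun n => X.qnorm (g - f n)) atTop (𝓝 0) := by
  let h : ℕ → R → ℝ≥0∞ := fun n x => ‖(f (n + 1) - f n) x‖ₑ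
  have hm : ∀ n, Measurable (h n) := fun n => measurable_enorm _
  have hts := X.toFun_tsum_le hC1 hC hm hf
  have htm : ∀ n, Measurable fun x => ∑' k, h (n + k) x := fun n => Measurable.tsum fun k => hm _
  -- A sum of finite quasinorm is finite a.e., so the sequence is Cauchy at almost every point; the
  -- tails of the sum then dominate the error.
  have hae : ∀ᵐ x ∂μ, ∑' k, h k x ≠ ∞ := by
    have := X.ae_lt_top _ (htm 0) ((hts 0).trans_lt ENNReal.coe_lt_top)
    filter_upwards [this] with x hx
    simpa using hx.ne
  have hsub : ∀ᵐ x ∂μ, ∀ n, edist (f n x) (f (n + 1) x) ≤ h n x := ae_all_iff.2 fun n => by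
    filter_upwards [AEEqFun.coeFn_sub (f (n + 1)) (f n)] with x hx
    simp only [h, hx, Pi.sub_apply]
    rw [edist_comm, edist_eq_enorm_sub]
  have hconv : ∀ᵐ x ∂μ, ∃ l, Tendsto (fun n => f n x) atTop (𝓝 l) := by
    filter_upwards [hae, hsub] with x h1 h2
    exact cauchySeq_tendsto_of_complete (cauchySeq_of_edist_le_of_tsum_ne_top _ h2 h1)
  obtain ⟨g₀, hg₀, hlim⟩ := measurable_limit_of_tendsto_metrizable_ae (L := atTop)
    (fun n => (f n).measurable.aemeasurable) hconv
  refine ⟨AEEqFun.mk g₀ hg₀.aestronglyMeasurable, ?_⟩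
  set g : R →ₘ[μ] ℂ := AEEqFun.mk g₀ hg₀.aestronglyMeasurable with hg
  have hbound : ∀ n, X.qnorm (g - f n) ≤ ((2 * C * (2 * C)⁻¹ ^ n : ℝ≥0) : ℝ≥0∞) := by
    intro n
    refine le_trans (X.mono' _ _ (measurable_enorm _) (htm n) ?_) (hts n)
    filter_upwards [hsub, hlim, AEEqFun.coeFn_sub g (f n),
      AEEqFun.coeFn_mk g₀ hg₀.aestronglyMeasurable] with x h1 h2 h3 h4
    have := edist_le_tsum_of_edist_le_of_tendsto _ h1 h2 n
    rw [h3, Pi.sub_apply, hg, h4, ← edist_eq_enorm_sub, edist_comm]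
    exact this
  refine tendsto_of_tendsto_of_tendsto_of_le_of_le tendsto_const_nhds ?_ (fun _ => zero_le) hbound
  rw [← ENNReal.coe_zero, ENNReal.tendsto_coe]
  have hlt : (2 * C)⁻¹ < 1 := inv_lt_one_of_one_lt₀
    (one_lt_two.trans_le (le_mul_of_one_le_right zero_le_two hC1))
  simpa using (tendsto_pow_atTop_nhds_zero_of_lt_one zero_le hlt).const_mul (2 * C)

/-- A bounded linear operator on `X` that is bounded from below is injective and has closed
range. -/
theorem injectiveClosedRangeOn_of_boundedFromBelowOn {T : (R →ₘ[μ] ℂ) →ₗ[ℂ] (R →ₘ[μ] ℂ)} {K : ℝ≥0}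
    (hK : ∀ f, X.qnorm (T f) ≤ K * X.qnorm f) (hT : BoundedFromBelowOn X T) :
    InjectiveClosedRangeOn X T := by
  obtain ⟨c, hc0, hc⟩ := hT
  have hmap : ∀ f ∈ X.space, T f ∈ X.space := fun f hf =>
    (hK f).trans_lt (ENNReal.mul_lt_top ENNReal.coe_lt_top hf)
  refine ⟨hmap, ?_, ?_⟩
  · refine (injective_iff_map_eq_zero _).2 fun f hf => ?_
    have h0 : T f = 0 := congrArg Subtype.val hf
    have := hc f f.2
    rw [h0, X.qnorm_eq_zero_iff.2 rfl, mul_zero, nonpos_iff_eq_zero, X.qnorm_eq_zero_iff] at this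
    exact Subtype.ext this
  · obtain ⟨C, hC1, hC⟩ := X.add_le'
    let _ := X.topology
    refine ⟨fun y hy => ?_⟩
    by_contra hcon
    -- If the complement of the range is not open at `y`, every quasinorm ball around `y` meets the
    -- range.
    have hnear : ∀ ε : ℝ≥0∞, 0 < ε → ∃ f ∈ X.space, X.qnorm (T f - y) < ε := by
      intro ε hε
      by_contra hno
      refine hcon ⟨ε, hε, fun g hg hgr => hno ?_⟩
      obtain ⟨f, rfl⟩ := hgr
      exact ⟨f, f.2, hg⟩
    have hC0 : C ≠ 0 := (zero_lt_one.trans_le hC1).ne'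
    have hlt : (2 * C)⁻¹ < 1 := inv_lt_one_of_one_lt₀
      (one_lt_two.trans_le (le_mul_of_one_le_right zero_le_two hC1))
    -- Chosen so that `c * C * (η n + η n) = (2 * C)⁻¹ ^ n`, the increment bound that completeness
    -- requires of the preimages.
    let η : ℕ → ℝ≥0 := fun n => (2 * C)⁻¹ ^ n / (2 * (c * C))
    have hη : ∀ n, 0 < η n := fun n => by positivity
    have hηlim : Tendsto (fun n => (η n : ℝ≥0∞)) atTop (𝓝 0) := by
      rw [← ENNReal.coe_zero, ENNReal.tendsto_coe]
      simpa only [zero_div] using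
        (tendsto_pow_atTop_nhds_zero_of_lt_one zero_le hlt).div_const (2 * (c * C))
    choose f hfX hfy using fun n => hnear (η n) (ENNReal.coe_pos.2 (hη n))
    have hinc : ∀ n, X.qnorm (f (n + 1) - f n) ≤ (((2 * C)⁻¹ ^ n : ℝ≥0) : ℝ≥0∞) := by
      intro n
      have h1 := hc _ (X.space.sub_mem (hfX (n + 1)) (hfX n))
      rw [map_sub] at h1
      have h2 := X.qnorm_sub_le hC (T (f (n + 1))) y (T (f n))
      rw [X.qnorm_sub_comm y] at h2
      have h3 : X.qnorm (T (f (n + 1)) - y) + X.qnorm (T (f n) - y) ≤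
          ((η n + η n : ℝ≥0) : ℝ≥0∞) := by
        rw [ENNReal.coe_add]
        refine add_le_add ((hfy (n + 1)).le.trans (ENNReal.coe_le_coe.2 ?_)) (hfy n).le
        exact div_le_div_of_nonneg_right
          (pow_le_pow_of_le_one zero_le hlt.le n.le_succ) zero_le
      calc _ ≤ (c : ℝ≥0∞) * (C * ((η n + η n : ℝ≥0) : ℝ≥0∞)) := by
            refine h1.trans ?_
            gcongr
            refine h2.trans ?_
            gcongr
        _ = _ := by
            rw [← ENNReal.coe_mul, ← ENNReal.coe_mul, ENNReal.coe_inj]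
            simp only [η]
            field_simp
            ring
    obtain ⟨g, hg⟩ := X.exists_tendsto_qnorm_sub hC1 hC hinc
    have hgX : g ∈ X.space := by
      obtain ⟨n, hn⟩ := (hg.eventually_lt_const (ENNReal.zero_lt_top)).exists
      have hn' : g - f n ∈ X.space := hn
      simpa using X.space.add_mem hn' (hfX n)
    have hTg : T g - y = 0 := by
      rw [← X.qnorm_eq_zero_iff, ← nonpos_iff_eq_zero]
      have hb : ∀ n, X.qnorm (T g - y) ≤ C * (K * X.qnorm (g - f n) + η n) := fun n => by
        refine (X.qnorm_sub_le hC (T g) (T (f n)) y).trans ?_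
        gcongr
        · rw [← map_sub]
          exact hK _
        · exact (hfy n).le
      have hlim := ENNReal.Tendsto.const_mul (a := (C : ℝ≥0∞)) ((ENNReal.Tendsto.const_mul
        (a := (K : ℝ≥0∞)) hg (Or.inr ENNReal.coe_ne_top)).add hηlim) (Or.inr ENNReal.coe_ne_top)
      rw [mul_zero, add_zero, mul_zero] at hlim
      exact ge_of_tendsto' hlim hb
    exact hy ⟨⟨g, hgX⟩, Subtype.ext (sub_eq_zero.1 hTg)⟩

end RIQuasiNorm

/-! ### Bounds for the composition operator and the `L^1` criterion. -/

section Composition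

variable {R : Type*} [MeasurableSpace R] {μ : Measure R} {φ : R → R}

theorem qnorm_compOp (X : RIQuasiNorm μ) (h : Measure.QuasiMeasurePreserving φ μ μ)
    (f : R →ₘ[μ] ℂ) : X.qnorm (compOp h f) = X.toFun (fun x => ‖f (φ x)‖ₑ) := by
  refine X.toFun_congr_ae (RIQuasiNorm.measurable_enorm _)
    ((RIQuasiNorm.measurable_enorm f).comp h.measurable) ?_
  filter_upwards [AEEqFun.coeFn_compQuasiMeasurePreserving f h] with x hx
  change ‖(f.compQuasiMeasurePreserving φ h) x‖ₑ = _
  rw [hx, Function.comp_apply]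

theorem MeasureBounded.exists_qnorm_compOp_le [SigmaFinite μ] (hμ : Resonant μ)
    (hb : MeasureBounded μ φ) (hφ : Measurable φ) (X : RIQuasiNorm μ) :
    ∃ K : ℝ≥0, ∀ f, X.qnorm (compOp (hb.quasiMeasurePreserving hφ) f) ≤ K * X.qnorm f := by
  obtain ⟨A, -, hA⟩ := id hb
  obtain ⟨N, hN⟩ := exists_nat_ge A
  obtain ⟨K, hK⟩ := X.exists_toFun_le_of_distribution_le hμ N
  refine ⟨K, fun f => ?_⟩
  have hf := RIQuasiNorm.measurable_enorm f
  rw [qnorm_compOp]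
  refine hK _ _ (hf.comp hφ) hf fun s S _ _ => (measure_mono inter_subset_left).trans ?_
  refine (hA _ (measurableSet_lt measurable_const hf)).trans ?_
  gcongr
  · exact_mod_cast hN
  · exact le_rfl

/-- The dilation estimate applies to `|f|` and `|f ∘ φ|`. Its hypothesis tests level sets only
within sets of finite measure, which is where the lower bound on `φ` is available. -/
theorem MeasureBoundedBelow.boundedFromBelowOn_compOp [SigmaFinite μ] (hμ : Resonant μ)
    (h : MeasureBoundedBelow μ φ) (hq : Measure.QuasiMeasurePreserving φ μ μ)
    (X : RIQuasiNorm μ) : BoundedFromBelowOn X (compOp hq) := by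
  obtain ⟨C, -, hC⟩ := h
  obtain ⟨N, hN⟩ := exists_nat_ge C
  obtain ⟨K, hK⟩ := X.exists_toFun_le_of_distribution_le hμ N
  -- The added `1` only ensures a positive constant.
  refine ⟨K + 1, by positivity, fun f _ => ?_⟩
  have hf := RIQuasiNorm.measurable_enorm f
  rw [qnorm_compOp]
  refine (hK _ _ hf (hf.comp hq.measurable) fun s S hS hSfin => ?_).trans
    (mul_le_mul_left (ENNReal.coe_le_coe.2 le_self_add) _)
  refine (hC _ ((measurableSet_lt measurable_const hf).inter hS)
    ((measure_mono inter_subset_right).trans_lt hSfin)).trans ?_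
  gcongr
  · exact_mod_cast hN
  · exact measure_mono fun x hx => hx.1

theorem enorm_compL1 [SigmaFinite μ] (hb : MeasureBounded μ φ) (hφ : Measurable φ) (f : Lp ℂ 1 μ) :
    ‖compL1 hb hφ f‖ₑ = (l1Norm μ).qnorm (compOp (hb.quasiMeasurePreserving hφ) f) :=
  (qnorm_l1Norm_coe _).symm

theorem MeasureBounded.exists_norm_compL1_le [SigmaFinite μ] (hμ : Resonant μ)
    (hb : MeasureBounded μ φ) (hφ : Measurable φ) :
    ∃ K : ℝ, ∀ f, ‖compL1 hb hφ f‖ ≤ K * ‖f‖ := by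
  obtain ⟨K, hK⟩ := hb.exists_qnorm_compOp_le hμ hφ (l1Norm μ)
  refine ⟨K, fun f => ?_⟩
  have := hK (f : R →ₘ[μ] ℂ)
  rw [← enorm_compL1, qnorm_l1Norm_coe, enorm_eq_nnnorm, enorm_eq_nnnorm] at this
  exact_mod_cast this

theorem enorm_compL1_indicatorConstLp [SigmaFinite μ] (hb : MeasureBounded μ φ) (hφ : Measurable φ)
    {E : Set R} (hE : MeasurableSet E) (hfin : μ E ≠ ∞) :
    ‖compL1 hb hφ (indicatorConstLp 1 hE hfin 1)‖ₑ = μ (φ ⁻¹' E) := by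
  rw [enorm_compL1, qnorm_compOp]
  change ∫⁻ x, ‖(indicatorConstLp 1 hE hfin (1 : ℂ)) (φ x)‖ₑ ∂μ = _
  rw [← lintegral_indicator_one (hφ hE)]
  refine lintegral_congr_ae ?_
  filter_upwards [(hb.quasiMeasurePreserving hφ).ae
    (indicatorConstLp_coeFn (p := 1) (hs := hE) (hμs := hfin) (c := (1 : ℂ)))] with x hx
  rw [hx]
  by_cases hxE : φ x ∈ E <;> simp [hxE]

theorem injective_isClosed_range_compL1 [SigmaFinite μ] (hμ : Resonant μ)
    (hb : MeasureBounded μ φ) (hφ : Measurable φ)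
    (h : BoundedFromBelowOn (l1Norm μ) (compOp (hb.quasiMeasurePreserving hφ))) :
    Function.Injective (compL1 hb hφ) ∧ IsClosed (range (compL1 hb hφ)) := by
  obtain ⟨c, -, hc⟩ := h
  obtain ⟨K, hK⟩ := hb.exists_norm_compL1_le hμ hφ
  let T := (compL1 hb hφ).mkContinuous K hK
  have hT : AntilipschitzWith c T := T.antilipschitz_of_bound fun f => by
    have := hc f (by
      change (l1Norm μ).qnorm _ < ∞
      rw [qnorm_l1Norm_coe]
      exact enorm_lt_top)
    rw [← enorm_compL1 hb hφ, qnorm_l1Norm_coe, enorm_eq_nnnorm, enorm_eq_nnnorm] at this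
    exact_mod_cast this
  exact ⟨hT.injective, hT.isClosed_range T.uniformContinuous⟩

/-- By the open mapping theorem `T_φ` is bounded from below on `L^1`; on `χ_E` the two norms are `μ
E` and `μ (φ ⁻¹' E)`. -/
theorem measureBoundedBelow_of_injective_isClosed_range [SigmaFinite μ] (hμ : Resonant μ)
    (hb : MeasureBounded μ φ) (hφ : Measurable φ) (hinj : Function.Injective (compL1 hb hφ))
    (hcl : IsClosed (range (compL1 hb hφ))) : MeasureBoundedBelow μ φ := by
  obtain ⟨K, hK⟩ := hb.exists_norm_compL1_le hμ hφ
  let T := (compL1 hb hφ).mkContinuous K hK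
  obtain ⟨c, hc⟩ := T.antilipschitz_of_injective_of_isClosed_range hinj hcl
  refine ⟨c + 1, by positivity, fun E hE hfin => ?_⟩
  have h1 := hc (indicatorConstLp 1 hE hfin.ne 1) 0
  rw [map_zero, edist_zero_right, edist_zero_right] at h1
  change _ ≤ (c : ℝ≥0∞) * ‖compL1 hb hφ _‖ₑ at h1
  rw [enorm_compL1_indicatorConstLp, Lp.enorm_def, eLpNorm_congr_ae indicatorConstLp_coeFn,
    eLpNorm_indicator_const hE one_ne_zero ENNReal.one_ne_top] at h1
  simp only [enorm_one, ENNReal.toReal_one, div_one, ENNReal.rpow_one, one_mul] at h1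
  refine h1.trans ?_
  gcongr
  exact le_self_add

end Composition

end RISpace

theorem mainTheorem12 {R : Type*} [MeasurableSpace R] (μ : MeasureTheory.Measure R)
    [MeasureTheory.SigmaFinite μ] (hμ : RISpace.Resonant μ)
    (φ : R → R) (hφ : Measurable φ) (hb : RISpace.MeasureBounded μ φ) :
    List.TFAE
      [ RISpace.MeasureBoundedBelow μ φ,
        Function.Injective (RISpace.compL1 hb hφ) ∧
          IsClosed (Set.range (RISpace.compL1 hb hφ)),
        ∀ X : RISpace.RIQuasiNorm μ,
          RISpace.BoundedFromBelowOn X (RISpace.compOp (hb.quasiMeasurePreserving hφ)) ] ∧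
    ∀ X : RISpace.RIQuasiNorm μ,
      RISpace.BoundedFromBelowOn X (RISpace.compOp (hb.quasiMeasurePreserving hφ)) →
        RISpace.InjectiveClosedRangeOn X (RISpace.compOp (hb.quasiMeasurePreserving hφ)) := by
  refine ⟨?_, fun X hX => ?_⟩
  · tfae_have 1 → 3 := fun h X => h.boundedFromBelowOn_compOp hμ _ X
    tfae_have 3 → 2 := fun h => RISpace.injective_isClosed_range_compL1 hμ hb hφ (h _)
    tfae_have 2 → 1 := fun h =>
      RISpace.measureBoundedBelow_of_injective_isClosed_range hμ hb hφ h.1 h.2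
    tfae_finish
  · obtain ⟨K, hK⟩ := hb.exists_qnorm_compOp_le hμ hφ X
    exact X.injectiveClosedRangeOn_of_boundedFromBelowOn hK hX
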